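/- Let $G=(V,E)$ be a connected, locally finite, simple undirected graph (finite or infinite), and write $y\sim x$ for adjacency and $d_x$ for the degree of $x$. Suppose that $G$ is $C_4$-free, that is, $G$ contains no (not necessarily induced) subgraph isomorphic to the $4$-cycle, and that the minimum degree satisfies $\delta(G)=\inf_{x\in V}d_x\ge 2$. Equip $G$ with the unweighted normalized Laplacian $$\Delta f(x)=\frac1{d_x}\sum_{y\sim x}\bigl(f(y)-f(x)\bigr),\qquad f:V\to\mathbb R,\ x\in V,$$ and put, for $f,g:V\to\mathbb R$, $$2\Gamma(f,g)=\Delta(fg)-f\Delta g-g\Delta f,\qquad 2\Gamma_2(f,g)=\Delta\Gamma(f,g)-\Gamma(f,\Delta g)-\Gamma(\Delta f,g).$$ For $K\in\mathbb R$ and $N\in(0,\infty]$, $G$ satisfies $CD(K,N)$ if $\Gamma_2(f,f)(x)\ge \frac1N(\Delta f(x))^2+K\,\Gamma(f,f)(x)$ for all $f:V\to\mathbb R$ and all $x\in V$, where $\frac1\infty=0$; in particular $CD(0,\infty)$ means $\Gamma_2(f,f)(x)\ge 0$ for all $f$ and all $x$. Then $G$ satisfies $CD(0,\infty)$ if and only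 if $G$ is isomorphic to one of the following graphs: 1. the cycle $C_n$ for some $n\ge 5$, or the infinite line $P_{\mathbb Z}$ (vertex set $\mathbb Z$, with $i\sim j$ if and only if $|i-j|=1$); 2. the friendship graph $F_k$ for some $1\le k\le 7$, obtained from $k$ triangles by identifying one vertex of each to a single common vertex. -/

import Mathlib

namespace BakryEmery

noncomputable section

open scoped ENNReal

variable {V : Type*} (G : SimpleGraph V) [G.LocallyFinite]

/-- The vertex weight `μ_x = ∑_{y ∼ x} μ_{xy}` induced by edge weights `μ`. -/
def vertexWeight (μ : V → V → ℝ) (x : V) : ℝ :=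
  ∑ y ∈ G.neighborFinset x, μ x y

/-- The Laplacian `Δ f(x) = (1 / m_x) ∑_{y ∼ x} μ_{xy} (f(y) - f(x))` of the locally finite graph
`G` with edge weights `μ` and vertex weights `m`. -/
def laplacian (μ : V → V → ℝ) (m : V → ℝ) (f : V → ℝ) (x : V) : ℝ :=
  1 / m x * ∑ y ∈ G.neighborFinset x, μ x y * (f y - f x)

/-- `2 Γ(f, g) = Δ(f g) - f Δ g - g Δ f`. -/
def gamma (μ : V → V → ℝ) (m : V → ℝ) (f g : V → ℝ) (x : V) : ℝ :=
  (laplacian G μ m (fun y => f y * g y) x - f x * laplacian G μ m g x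
    - g x * laplacian G μ m f x) / 2

/-- `2 Γ₂(f, g) = Δ Γ(f, g) - Γ(f, Δ g) - Γ(Δ f, g)`. -/
def gammaTwo (μ : V → V → ℝ) (m : V → ℝ) (f g : V → ℝ) (x : V) : ℝ :=
  (laplacian G μ m (gamma G μ m f g) x - gamma G μ m f (laplacian G μ m g) x
    - gamma G μ m (laplacian G μ m f) g x) / 2

/-- The curvature dimension condition `CD(K, N)`, for `K` real and `N ∈ (0, ∞]`: at every vertex
and for every function, `Γ₂(f) ≥ (1 / N) (Δ f)² + K Γ(f)`, where `1 / ∞ = 0`. -/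
def CD (μ : V → V → ℝ) (m : V → ℝ) (K : ℝ) (N : ℝ≥0∞) : Prop :=
  ∀ (x : V) (f : V → ℝ),
    (N⁻¹).toReal * laplacian G μ m f x ^ 2 + K * gamma G μ m f f x ≤ gammaTwo G μ m f f x

/-- `CD(K, N)` for the unweighted normalized Laplacian: `μ ≡ 1` on edges and `m_x = μ_x`. -/
def NormalizedCD (K : ℝ) (N : ℝ≥0∞) : Prop :=
  CD G (fun _ _ => 1) (vertexWeight G fun _ _ => 1) K N

end

/-- The infinite line: the integers, with consecutive integers adjacent. -/
noncomputable abbrev infiniteLine : SimpleGraph ℤ := SimpleGraph.hasse ℤ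

/-- The friendship graph made of `k` triangles sharing the vertex `none`; the `i`-th triangle has
the vertices `none`, `some (i, false)` and `some (i, true)`. -/
def friendshipGraph (k : ℕ) : SimpleGraph (Option (Fin k × Bool)) where
  Adj u v := u ≠ v ∧ (u = none ∨ v = none ∨ u.map Prod.fst = v.map Prod.fst)
  symm := ⟨fun _ _ h => ⟨h.1.symm, by tauto⟩⟩
  loopless := ⟨fun _ h => h.1 rfl⟩

end BakryEmery

/-!
For a function `f` and a vertex `x`, the number `2 d_x Γ₂(f, f)(x)` equals the quadratic form
`SimpleGraph.curvatureForm`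

`∑_{y ∼ x} [(1 / (2 d_y)) ∑_{z ∼ y} (f z - 2 f y + f x)² - (f y - f x)²]
  + (1 / d_x) (∑_{y ∼ x} (f y - f x))²`,

so that `CD(0, ∞)` says that these forms are nonnegative. If all neighbours of `x` have degree two,
the summands `z = x` already outweigh the negative terms; this settles cycles, the line and the
centre of a friendship graph. At another vertex of a friendship graph the form is bounded below by
one in two variables, which is nonnegative if the centre has degree at most `14`.

Conversely, without `4`-cycles each vertex at distance two from `x` has a single neighbour in common
with `x`, so its value can be chosen such that its second difference vanishes. What is left
(`reducedForm_nonneg`) is a form in the values on the neighbours of `x`, which couples these only in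
the triangles at `x` and through the square of the sum. Explicit test vectors show three things:

* an edge in no triangle ends in vertices of degree two
  (`degree_eq_two_of_no_common_neighbor`);
* if all edges are in triangles, two adjacent vertices do not both have degree greater than two
  (`degree_eq_two_of_adj_of_three_le_degree`);
* in a triangle with two vertices of degree two, the third one has degree at most `15`
  (`degree_le_of_triangle`).

If some edge is in no triangle, the first fact spreads along edges, so the graph is two-regular and
triangle-free. Walking straight ahead covers a connected two-regular graph by the line, and the deck
group is trivial or generated by a translation by some `n`, where `n ≥ 5` by the lack of triangles
and `4`-cycles. If all edges are in triangles, there is a vertex all of whose neighbours have degree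
two; by connectedness nothing lies beyond these neighbours, which are matched in pairs by the
triangles, so the graph is a friendship graph, of an even central degree at most `15`.
-/

namespace SimpleGraph

/-! ### The curvature form -/

section CurvatureForm

variable {V : Type*} (G : SimpleGraph V) [G.LocallyFinite]

/-- The contribution of the neighbour `y` to the curvature form at `x`. -/
noncomputable def curvatureTerm (f : V → ℝ) (x y : V) : ℝ :=
  (∑ z ∈ G.neighborFinset y, (f z - 2 * f y + f x) ^ 2) / (2 * G.degree y) - (f y - f x) ^ 2

/-- The quadratic form `2 d_x Γ₂(f, f)(x)` of the normalized Laplacian, written as a weighted sum of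
squares of second differences along the paths `x, y, z`, minus the squares of the first differences,
plus `d_x` times the square of the Laplacian. -/
noncomputable def curvatureForm (f : V → ℝ) (x : V) : ℝ :=
  ∑ y ∈ G.neighborFinset x, G.curvatureTerm f x y
    + (∑ y ∈ G.neighborFinset x, (f y - f x)) ^ 2 / G.degree x

theorem vertexWeight_one (x : V) :
    BakryEmery.vertexWeight G (fun _ _ => 1) x = G.degree x := by
  simp [BakryEmery.vertexWeight]

theorem normalized_laplacian_eq (f : V → ℝ) (x : V) :
    BakryEmery.laplacian G (fun _ _ => 1) (BakryEmery.vertexWeight G fun _ _ => 1) f x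
      = (∑ y ∈ G.neighborFinset x, (f y - f x)) / G.degree x := by
  rw [BakryEmery.laplacian, vertexWeight_one]
  simp only [one_mul]
  ring

theorem normalized_gamma_eq (f g : V → ℝ) (x : V) :
    BakryEmery.gamma G (fun _ _ => 1) (BakryEmery.vertexWeight G fun _ _ => 1) f g x
      = (∑ y ∈ G.neighborFinset x, (f y - f x) * (g y - g x)) / (2 * G.degree x) := by
  have key : ∑ y ∈ G.neighborFinset x, (f y - f x) * (g y - g x)
      = ∑ y ∈ G.neighborFinset x, (f y * g y - f x * g x)
        - f x * ∑ y ∈ G.neighborFinset x, (g y - g x)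
        - g x * ∑ y ∈ G.neighborFinset x, (f y - f x) := by
    rw [Finset.mul_sum, Finset.mul_sum, ← Finset.sum_sub_distrib, ← Finset.sum_sub_distrib]
    exact Finset.sum_congr rfl fun y _ => by ring
  rw [BakryEmery.gamma, normalized_laplacian_eq, normalized_laplacian_eq, normalized_laplacian_eq,
    key]
  ring

theorem normalized_gammaTwo_eq (f : V → ℝ) {x : V} (hx : G.degree x ≠ 0) :
    BakryEmery.gammaTwo G (fun _ _ => 1) (BakryEmery.vertexWeight G fun _ _ => 1) f f x
      = G.curvatureForm f x / (2 * G.degree x) := by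
  set L := BakryEmery.laplacian G (fun _ _ => 1) (BakryEmery.vertexWeight G fun _ _ => 1) f with hL
  set Γ := BakryEmery.gamma G (fun _ _ => 1) (BakryEmery.vertexWeight G fun _ _ => 1) f f with hΓ
  have hd : (G.degree x : ℝ) ≠ 0 := by exact_mod_cast hx
  have hterm : ∀ y ∈ G.neighborFinset x,
      Γ y - (f y - f x) * L y = G.curvatureTerm f x y + (f y - f x) ^ 2 / 2 := by
    intro y hy
    have hy0 : (G.degree y : ℝ) ≠ 0 := by
      have hxy : G.Adj y x := ((G.mem_neighborFinset x y).1 hy).symm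
      have : 0 < G.degree y := (G.degree_pos_iff_exists_adj y).2 ⟨x, hxy⟩
      exact_mod_cast this.ne'
    have hsq : ∑ z ∈ G.neighborFinset y, (f z - 2 * f y + f x) ^ 2
        = ∑ z ∈ G.neighborFinset y, (f z - f y) * (f z - f y)
          - 2 * (f y - f x) * ∑ z ∈ G.neighborFinset y, (f z - f y)
          + G.degree y * (f y - f x) ^ 2 := by
      rw [Finset.mul_sum, ← Finset.sum_sub_distrib, ← G.card_neighborFinset_eq_degree,
        ← nsmul_eq_mul, ← Finset.sum_const, ← Finset.sum_add_distrib]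
      exact Finset.sum_congr rfl fun z _ => by ring
    rw [hΓ, hL, normalized_gamma_eq, normalized_laplacian_eq, curvatureTerm, hsq]
    field_simp
    ring
  have hconst : ∑ y ∈ G.neighborFinset x, Γ x = ∑ y ∈ G.neighborFinset x, (f y - f x) ^ 2 / 2 := by
    rw [Finset.sum_const, G.card_neighborFinset_eq_degree, nsmul_eq_mul, hΓ, normalized_gamma_eq,
      ← Finset.sum_div]
    simp only [← sq]
    field_simp
  have hsum : ∑ y ∈ G.neighborFinset x, (Γ y - Γ x)
      - ∑ y ∈ G.neighborFinset x, (f y - f x) * (L y - L x) = G.curvatureForm f x := by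
    have h1 : ∑ y ∈ G.neighborFinset x, (Γ y - Γ x)
        - ∑ y ∈ G.neighborFinset x, (f y - f x) * (L y - L x)
        = ∑ y ∈ G.neighborFinset x, (Γ y - (f y - f x) * L y) - ∑ y ∈ G.neighborFinset x, Γ x
          + L x * ∑ y ∈ G.neighborFinset x, (f y - f x) := by
      rw [Finset.mul_sum, ← Finset.sum_sub_distrib, ← Finset.sum_sub_distrib,
        ← Finset.sum_add_distrib]
      exact Finset.sum_congr rfl fun z _ => by ring
    rw [h1, Finset.sum_congr rfl hterm, Finset.sum_add_distrib, hconst, hL, normalized_laplacian_eq,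
      curvatureForm]
    ring
  have hsymm : BakryEmery.gamma G (fun _ _ => 1) (BakryEmery.vertexWeight G fun _ _ => 1) L f x
      = BakryEmery.gamma G (fun _ _ => 1) (BakryEmery.vertexWeight G fun _ _ => 1) f L x := by
    rw [normalized_gamma_eq, normalized_gamma_eq]
    simp only [mul_comm]
  rw [BakryEmery.gammaTwo, ← hL, ← hΓ, hsymm, normalized_laplacian_eq, normalized_gamma_eq, ← hsum]
  field_simp
  ring

/-- Nonnegative curvature is nonnegativity of the curvature form. -/
theorem normalizedCD_zero_top_iff (hdeg : ∀ x, 2 ≤ G.degree x) :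
    BakryEmery.NormalizedCD G 0 ⊤ ↔ ∀ x f, 0 ≤ G.curvatureForm f x := by
  simp only [BakryEmery.NormalizedCD, BakryEmery.CD, ENNReal.inv_top, ENNReal.toReal_zero, zero_mul,
    add_zero]
  refine forall_congr' fun x => forall_congr' fun f => ?_
  have hx : G.degree x ≠ 0 := by have := hdeg x; omega
  have hpos : (0 : ℝ) < 2 * G.degree x := by positivity
  rw [normalized_gammaTwo_eq G f hx, le_div_iff₀ hpos, zero_mul]

variable {G}

theorem curvatureTerm_nonneg_of_degree_eq_two {x y : V} (h : G.Adj x y) (hy : G.degree y = 2)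
    (f : V → ℝ) : 0 ≤ G.curvatureTerm f x y := by
  -- The summand `z = x` alone is `4 (f y - f x) ^ 2`, which compensates the negative term.
  have hle := Finset.single_le_sum (f := fun z => (f z - 2 * f y + f x) ^ 2)
    (fun z _ => sq_nonneg _) ((G.mem_neighborFinset y x).2 h.symm)
  rw [curvatureTerm, hy]
  push_cast
  linarith [sq_nonneg (f y - f x)]

theorem curvatureForm_nonneg_of_degree_eq_two {x : V} (hx : ∀ y, G.Adj x y → G.degree y = 2)
    (f : V → ℝ) : 0 ≤ G.curvatureForm f x :=
  add_nonneg (Finset.sum_nonneg fun y hy => by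
    have hxy := (G.mem_neighborFinset x y).1 hy
    exact curvatureTerm_nonneg_of_degree_eq_two hxy (hx y hxy) f) (by positivity)

theorem neighborFinset_eq_pair {x u v : V} [DecidableEq V] (hx : G.degree x = 2) (hu : G.Adj x u)
    (hv : G.Adj x v) (huv : u ≠ v) : G.neighborFinset x = {u, v} := by
  symm
  apply Finset.eq_of_subset_of_card_le
  · intro z hz
    simp only [Finset.mem_insert, Finset.mem_singleton] at hz
    rcases hz with rfl | rfl <;> simpa
  · rw [G.card_neighborFinset_eq_degree, hx, Finset.card_pair huv]

/-- A vertex of degree two whose other neighbours are a vertex of degree two and a vertex `c` of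
degree at most `14`, all three forming a triangle, has nonnegative curvature. -/
theorem curvatureForm_nonneg_of_triangle {x w c : V} (hxw : G.Adj x w) (hxc : G.Adj x c)
    (hwc : G.Adj w c) (hx : G.degree x = 2) (hw : G.degree w = 2) (hc : G.degree c ≤ 14)
    (f : V → ℝ) : 0 ≤ G.curvatureForm f x := by
  classical
  have hN := neighborFinset_eq_pair hx hxw hxc hwc.ne
  have hNw := neighborFinset_eq_pair hw hxw.symm hwc hxc.ne
  have hsub : ({x, w} : Finset V) ⊆ G.neighborFinset c := by
    intro z hz
    simp only [Finset.mem_insert, Finset.mem_singleton] at hz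
    rcases hz with rfl | rfl
    · simpa using hxc.symm
    · simpa using hwc.symm
  have hle := Finset.sum_le_sum_of_subset_of_nonneg (f := fun z => (f z - 2 * f c + f x) ^ 2) hsub
    fun z _ _ => sq_nonneg _
  rw [Finset.sum_pair hxw.ne] at hle
  have hc0 : 0 < G.degree c := (G.degree_pos_iff_exists_adj c).2 ⟨x, hxc.symm⟩
  have hcR : (0 : ℝ) < 2 * G.degree c := by positivity
  have hcR' : (2 : ℝ) * G.degree c ≤ 28 := by
    have : (G.degree c : ℝ) ≤ 14 := by exact_mod_cast hc
    linarith
  have hdiv : ((f x - 2 * f c + f x) ^ 2 + (f w - 2 * f c + f x) ^ 2) / 28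
      ≤ (∑ z ∈ G.neighborFinset c, (f z - 2 * f c + f x) ^ 2) / (2 * G.degree c) :=
    div_le_div₀ (le_trans (by positivity) hle) hle hcR hcR'
  rw [curvatureForm, hN, Finset.sum_pair hwc.ne, Finset.sum_pair hwc.ne, curvatureTerm,
    curvatureTerm, hNw, Finset.sum_pair hxc.ne, hx, hw]
  push_cast
  nlinarith [sq_nonneg (f c - f x - 2 * (f w - f x)), sq_nonneg (f w - f x)]

end CurvatureForm

/-! ### Optimal test functions on graphs without four-cycles -/

section TestFunctions

variable {V : Type*} {G : SimpleGraph V}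

/-- In a graph without `4`-cycles two distinct vertices have at most one common neighbour. -/
theorem eq_of_common_neighbors (hC4 : (cycleGraph 4).Free G) {u v a b : V} (huv : u ≠ v)
    (hua : G.Adj u a) (hva : G.Adj v a) (hub : G.Adj u b) (hvb : G.Adj v b) : a = b := by
  by_contra hab
  refine hC4 ⟨⟨⟨![u, a, v, b], ?_⟩, ?_⟩⟩
  · intro i j hij
    rw [cycleGraph_adj] at hij
    fin_cases i <;> fin_cases j <;>
      first
        | exact absurd hij (by decide)
        | simp [hua, hva, hub, hvb, hua.symm, hva.symm, hub.symm, hvb.symm]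
  · intro i j hij
    have := hua.ne
    have := hva.ne
    have := hub.ne
    have := hvb.ne
    fin_cases i <;> fin_cases j <;> simp_all

variable [G.LocallyFinite]

variable (G) in
open Classical in
/-- The extension of a function `a` on the neighbours of `x` that minimizes the curvature form at
`x`: it vanishes at `x`, and at distance two it makes the second differences along paths from `x`
vanish, as there is just one such path to each vertex when there are no `4`-cycles. -/
noncomputable def radialExtension (x : V) (a : V → ℝ) (z : V) : ℝ :=
  if z = x then 0 else if G.Adj x z then a z else 2 * ∑ y ∈ G.neighborFinset x with G.Adj y z, a y

variable (G) in
open Classical in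
/-- The contribution of the neighbour `y` of `x` to the curvature form of `radialExtension G x a`;
the sum is over the common neighbours `z` of `x` and `y`. -/
noncomputable def reducedTerm (x : V) (a : V → ℝ) (y : V) : ℝ :=
  (4 * a y ^ 2 + ∑ z ∈ G.neighborFinset x with G.Adj y z, (a z - 2 * a y) ^ 2) / (2 * G.degree y)
    - a y ^ 2

theorem curvatureTerm_radialExtension (hC4 : (cycleGraph 4).Free G) {x y : V} (hxy : G.Adj x y)
    (a : V → ℝ) : G.curvatureTerm (G.radialExtension x a) x y = G.reducedTerm x a y := by
  classical
  have hx : G.radialExtension x a x = 0 := by simp [radialExtension]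
  have hN : ∀ z, G.Adj x z → G.radialExtension x a z = a z := fun z hz => by
    simp [radialExtension, hz, hz.ne']
  have hfar : ∀ z, G.Adj y z → z ≠ x → ¬ G.Adj x z → G.radialExtension x a z = 2 * a y := by
    intro z hyz hzx hxz
    have hfilter : {u ∈ G.neighborFinset x | G.Adj u z} = {y} := by
      ext u
      simp only [Finset.mem_filter, mem_neighborFinset, Finset.mem_singleton]
      constructor
      · rintro ⟨h1, h2⟩
        exact eq_of_common_neighbors hC4 hzx h2.symm h1 hyz.symm hxy
      · rintro rfl
        exact ⟨hxy, hyz⟩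
    simp only [radialExtension, if_neg hzx, if_neg hxz, hfilter, Finset.sum_singleton]
  rw [curvatureTerm, reducedTerm, hx, hN y hxy]
  congr 2
  · have hsub : insert x {z ∈ G.neighborFinset x | G.Adj y z} ⊆ G.neighborFinset y := by
      intro z hz
      simp only [Finset.mem_insert, Finset.mem_filter, mem_neighborFinset] at hz ⊢
      rcases hz with rfl | hz
      exacts [hxy.symm, hz.2]
    rw [← Finset.sum_subset hsub, Finset.sum_insert (by simp), hx]
    · congr 1
      · ring
      · refine Finset.sum_congr rfl fun z hz => ?_
        simp only [Finset.mem_filter, mem_neighborFinset] at hz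
        rw [hN z hz.1, add_zero]
    · intro z hz hz'
      simp only [Finset.mem_insert, Finset.mem_filter, mem_neighborFinset, not_or, not_and] at hz hz'
      rw [hfar z hz hz'.1 fun h => hz'.2 h hz]
      ring
  · ring

/-- If the curvature form is nonnegative at `x`, it may be tested on functions supported on a set
of neighbours of `x` that contains, with each vertex, its common neighbours with `x`. -/
theorem reducedForm_nonneg (hC4 : (cycleGraph 4).Free G) {x : V}
    (hx : ∀ f, 0 ≤ G.curvatureForm f x) {S : Finset V} (hS : ∀ s ∈ S, G.Adj x s)
    (hclosed : ∀ s ∈ S, ∀ z, G.Adj x z → G.Adj s z → z ∈ S) {a : V → ℝ} (ha : ∀ z ∉ S, a z = 0) :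
    0 ≤ ∑ y ∈ S, G.reducedTerm x a y + (∑ y ∈ S, a y) ^ 2 / G.degree x := by
  classical
  have hSN : S ⊆ G.neighborFinset x := fun s hs => by simpa using hS s hs
  refine (hx (G.radialExtension x a)).trans_eq ?_
  rw [curvatureForm, Finset.sum_congr rfl fun y hy =>
    curvatureTerm_radialExtension hC4 ((G.mem_neighborFinset x y).1 hy) a]
  congr 1
  · refine (Finset.sum_subset hSN fun y hy hyS => ?_).symm
    have hzero : ∑ z ∈ G.neighborFinset x with G.Adj y z, (a z - 2 * a y) ^ 2 = 0 := by
      refine Finset.sum_eq_zero fun z hz => ?_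
      simp only [Finset.mem_filter, mem_neighborFinset] at hz hy
      rw [ha y hyS, ha z fun hzS => hyS (hclosed z hzS y hy hz.2.symm)]
      ring
    rw [reducedTerm, hzero, ha y hyS]
    simp
  · rw [Finset.sum_subset (f := a) hSN fun y _ hyS => ha y hyS]
    congr 2
    refine Finset.sum_congr rfl fun y hy => ?_
    rw [mem_neighborFinset] at hy
    simp [radialExtension, hy, hy.ne']

theorem reducedTerm_of_no_common_neighbor {x y : V} (h : ∀ z, G.Adj x z → ¬ G.Adj y z)
    (a : V → ℝ) : G.reducedTerm x a y = 4 * a y ^ 2 / (2 * G.degree y) - a y ^ 2 := by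
  classical
  rw [reducedTerm, Finset.sum_eq_zero, add_zero]
  intro z hz
  simp only [Finset.mem_filter, mem_neighborFinset] at hz
  exact absurd hz.2 (h z hz.1)

theorem reducedTerm_of_triangle (hC4 : (cycleGraph 4).Free G) {x y y' : V} (hxy : G.Adj x y)
    (hxy' : G.Adj x y') (hyy' : G.Adj y y') (a : V → ℝ) :
    G.reducedTerm x a y = (4 * a y ^ 2 + (a y' - 2 * a y) ^ 2) / (2 * G.degree y) - a y ^ 2 := by
  classical
  have hfilter : {z ∈ G.neighborFinset x | G.Adj y z} = {y'} := by
    ext z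
    simp only [Finset.mem_filter, mem_neighborFinset, Finset.mem_singleton]
    constructor
    · rintro ⟨h1, h2⟩
      exact eq_of_common_neighbors hC4 hxy.ne h1 h2 hxy' hyy'
    · rintro rfl
      exact ⟨hxy', hyy'⟩
  rw [reducedTerm, ← Finset.sum_singleton (fun z => (a z - 2 * a y) ^ 2) y', ← hfilter]

theorem div_two_mul_degree_le {x : V} {n : ℕ} (hn : n ≠ 0) (h : n ≤ G.degree x) {c : ℝ}
    (hc : 0 ≤ c) : c / (2 * G.degree x) ≤ c / (2 * n) := by
  have hn' : (0 : ℝ) < n := by positivity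
  have : (n : ℝ) ≤ G.degree x := by exact_mod_cast h
  gcongr

/-- An edge in no triangle ends in vertices of degree two. -/
theorem degree_eq_two_of_no_common_neighbor (hC4 : (cycleGraph 4).Free G)
    (hdeg : ∀ x, 2 ≤ G.degree x) {x y : V} (hx : ∀ f, 0 ≤ G.curvatureForm f x) (hxy : G.Adj x y)
    (hno : ∀ z, G.Adj x z → ¬ G.Adj y z) : G.degree y = 2 := by
  classical
  by_contra hne
  have hy : 3 ≤ G.degree y := by have := hdeg y; omega
  obtain ⟨w, hw, hwy⟩ : ∃ w ∈ G.neighborFinset x, w ≠ y :=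
    Finset.exists_mem_ne (by rw [card_neighborFinset_eq_degree]; have := hdeg x; omega) y
  rw [mem_neighborFinset] at hw
  by_cases hmate : ∃ w', G.Adj x w' ∧ G.Adj w w'
  · obtain ⟨w', hxw', hww'⟩ := hmate
    have hw'y : w' ≠ y := fun h => hno w hw (h ▸ hww'.symm)
    -- The test function is `1` at `y` and `-1/2` at `w` and `w'`, so its sum vanishes.
    let a : V → ℝ := fun z => if z = y then 1 else if z = w ∨ z = w' then -1 / 2 else 0
    have hay : a y = 1 := by simp [a]
    have haw : a w = -1 / 2 := by simp [a, hwy]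
    have haw' : a w' = -1 / 2 := by simp [a, hw'y]
    have key := reducedForm_nonneg (a := a) hC4 hx (S := {y, w, w'})
      (by simp [hxy, hw, hxw'])
      (by
        intro s hs z hxz hsz
        simp only [Finset.mem_insert, Finset.mem_singleton] at hs ⊢
        rcases hs with rfl | rfl | rfl
        · exact absurd hsz (hno z hxz)
        · exact Or.inr (Or.inr (eq_of_common_neighbors hC4 hw.ne hxz hsz hxw' hww'))
        · exact Or.inr (Or.inl (eq_of_common_neighbors hC4 hxw'.ne hxz hsz hw hww'.symm)))
      (by simp +contextual [a])
    rw [Finset.sum_insert (by simp [hwy.symm, hw'y.symm]), Finset.sum_pair hww'.ne,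
      Finset.sum_insert (by simp [hwy.symm, hw'y.symm]), Finset.sum_pair hww'.ne,
      reducedTerm_of_no_common_neighbor hno, reducedTerm_of_triangle hC4 hw hxw' hww',
      reducedTerm_of_triangle hC4 hxw' hw hww'.symm, hay, haw, haw'] at key
    have h1 := div_two_mul_degree_le (G := G) (by norm_num) hy (c := 4 * 1 ^ 2) (by norm_num)
    have h2 := div_two_mul_degree_le (G := G) (by norm_num) (hdeg w)
      (c := 4 * (-1 / 2) ^ 2 + (-1 / 2 - 2 * (-1 / 2)) ^ 2) (by norm_num)
    have h3 := div_two_mul_degree_le (G := G) (by norm_num) (hdeg w')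
      (c := 4 * (-1 / 2) ^ 2 + (-1 / 2 - 2 * (-1 / 2)) ^ 2) (by norm_num)
    norm_num at key h1 h2 h3
    linarith
  · push Not at hmate
    let a : V → ℝ := fun z => if z = y then 1 else if z = w then -1 else 0
    have hay : a y = 1 := by simp [a]
    have haw : a w = -1 := by simp [a, hwy]
    have key := reducedForm_nonneg (a := a) hC4 hx (S := {y, w}) (by simp [hxy, hw])
      (by
        intro s hs z hxz hsz
        simp only [Finset.mem_insert, Finset.mem_singleton] at hs
        rcases hs with rfl | rfl
        exacts [absurd hsz (hno z hxz), absurd hsz (hmate z hxz)])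
      (by simp +contextual [a])
    rw [Finset.sum_pair hwy.symm, Finset.sum_pair hwy.symm, reducedTerm_of_no_common_neighbor hno,
      reducedTerm_of_no_common_neighbor hmate, hay, haw] at key
    have h1 := div_two_mul_degree_le (G := G) (by norm_num) hy (c := 4 * 1 ^ 2) (by norm_num)
    have h2 := div_two_mul_degree_le (G := G) (by norm_num) (hdeg w) (c := 4 * (-1) ^ 2)
      (by norm_num)
    norm_num at key h1 h2
    linarith

/-- If every edge lies in a triangle, every vertex of degree greater than two has only neighbours
of degree two. -/
theorem degree_eq_two_of_adj_of_three_le_degree (hC4 : (cycleGraph 4).Free G)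
    (hdeg : ∀ x, 2 ≤ G.degree x) (htri : ∀ x y, G.Adj x y → ∃ z, G.Adj x z ∧ G.Adj y z)
    {x y : V} (hx : ∀ f, 0 ≤ G.curvatureForm f x) (hxy : G.Adj x y) (hx3 : 3 ≤ G.degree x) :
    G.degree y = 2 := by
  classical
  have four_le : ∀ u v v' : V, G.Adj u v → G.Adj u v' → G.Adj v v' → 3 ≤ G.degree u →
      4 ≤ G.degree u ∧ ∃ w w', G.Adj u w ∧ G.Adj u w' ∧ G.Adj w w' ∧ w ≠ v ∧ w ≠ v' ∧ w' ≠ v ∧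
        w' ≠ v' := by
    intro u v v' huv huv' hvv' hu
    obtain ⟨w, hw, hwn⟩ : ∃ w ∈ G.neighborFinset u, w ∉ ({v, v'} : Finset V) :=
      Finset.exists_mem_notMem_of_card_lt_card (by
        rw [card_neighborFinset_eq_degree]
        exact lt_of_le_of_lt Finset.card_le_two hu)
    simp only [mem_neighborFinset, Finset.mem_insert, Finset.mem_singleton, not_or] at hw hwn
    obtain ⟨w', huw', hww'⟩ := htri u w hw
    have h1 : w' ≠ v := by
      rintro rfl
      exact hwn.2 (eq_of_common_neighbors hC4 huv.ne hw hww'.symm huv' hvv')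
    have h2 : w' ≠ v' := by
      rintro rfl
      exact hwn.1 (eq_of_common_neighbors hC4 huv'.ne hw hww'.symm huv hvv'.symm)
    refine ⟨?_, w, w', hw, huw', hww', hwn.1, hwn.2, h1, h2⟩
    rw [← card_neighborFinset_eq_degree]
    have hcard : ({v, v', w, w'} : Finset V).card = 4 := by
      rw [Finset.card_insert_of_notMem (by simp [hvv'.ne, Ne.symm hwn.1, h1.symm]),
        Finset.card_insert_of_notMem (by simp [Ne.symm hwn.2, h2.symm]), Finset.card_pair hww'.ne]
    rw [← hcard]
    refine Finset.card_le_card fun z hz => ?_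
    simp only [Finset.mem_insert, Finset.mem_singleton] at hz
    rcases hz with rfl | rfl | rfl | rfl <;> simpa
  by_contra hne
  obtain ⟨y', hxy', hyy'⟩ := htri x y hxy
  obtain ⟨hx4, w, w', hw, hw', hww', hwy, hwy', hw'y, hw'y'⟩ := four_le x y y' hxy hxy' hyy' hx3
  have hy4 : 4 ≤ G.degree y :=
    (four_le y x y' hxy.symm hyy' hxy' (by have := hdeg y; omega)).1
  -- These are nearly the minimizing values when the degrees of `x` and `y` are `4`.
  let a : V → ℝ := fun z => if z = y then 2 else if z = y' then 1 else
    if z = w ∨ z = w' then -1 else 0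
  have hay : a y = 2 := by simp [a]
  have hay' : a y' = 1 := by simp [a, hyy'.ne']
  have haw : a w = -1 := by simp [a, hwy, hwy']
  have haw' : a w' = -1 := by simp [a, hw'y, hw'y']
  have key := reducedForm_nonneg (a := a) hC4 hx (S := {y, y', w, w'})
    (by simp [hxy, hxy', hw, hw'])
    (by
      intro s hs z hxz hsz
      simp only [Finset.mem_insert, Finset.mem_singleton] at hs ⊢
      rcases hs with rfl | rfl | rfl | rfl
      · exact Or.inr (Or.inl (eq_of_common_neighbors hC4 hxy.ne hxz hsz hxy' hyy'))
      · exact Or.inl (eq_of_common_neighbors hC4 hxy'.ne hxz hsz hxy hyy'.symm)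
      · exact Or.inr (Or.inr (Or.inr (eq_of_common_neighbors hC4 hw.ne hxz hsz hw' hww')))
      · exact Or.inr (Or.inr (Or.inl (eq_of_common_neighbors hC4 hw'.ne hxz hsz hw hww'.symm))))
    (by simp +contextual [a])
  have hnotMem : y ∉ ({y', w, w'} : Finset V) := by simp [hyy'.ne, hwy.symm, hw'y.symm]
  have hnotMem' : y' ∉ ({w, w'} : Finset V) := by simp [hwy'.symm, hw'y'.symm]
  rw [Finset.sum_insert hnotMem, Finset.sum_insert hnotMem', Finset.sum_pair hww'.ne,
    Finset.sum_insert hnotMem, Finset.sum_insert hnotMem', Finset.sum_pair hww'.ne,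
    reducedTerm_of_triangle hC4 hxy hxy' hyy', reducedTerm_of_triangle hC4 hxy' hxy hyy'.symm,
    reducedTerm_of_triangle hC4 hw hw' hww', reducedTerm_of_triangle hC4 hw' hw hww'.symm,
    hay, hay', haw, haw'] at key
  have h1 := div_two_mul_degree_le (G := G) (by norm_num) hy4
    (c := 4 * 2 ^ 2 + (1 - 2 * 2) ^ 2) (by norm_num)
  have h2 := div_two_mul_degree_le (G := G) (by norm_num) (hdeg y')
    (c := 4 * 1 ^ 2 + (2 - 2 * 1) ^ 2) (by norm_num)
  have h3 := div_two_mul_degree_le (G := G) (by norm_num) (hdeg w)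
    (c := 4 * (-1) ^ 2 + (-1 - 2 * -1) ^ 2) (by norm_num)
  have h4 := div_two_mul_degree_le (G := G) (by norm_num) (hdeg w')
    (c := 4 * (-1) ^ 2 + (-1 - 2 * -1) ^ 2) (by norm_num)
  have h5 : ((2 : ℝ) + (1 + (-1 + -1))) ^ 2 / G.degree x ≤ 1 / 4 := by
    have : (4 : ℝ) ≤ G.degree x := by exact_mod_cast hx4
    norm_num
    rw [inv_le_comm₀ (by linarith) (by norm_num)]
    linarith
  norm_num at key h1 h2 h3 h4 h5
  linarith

/-- In a triangle `y, w, c` where `y` and `w` have degree two, `c` has degree at most `15`: the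
curvature form at `y` sees a large degree of `c`. -/
theorem degree_le_of_triangle (hC4 : (cycleGraph 4).Free G) {y w c : V}
    (hy : ∀ f, 0 ≤ G.curvatureForm f y) (hyw : G.Adj y w) (hyc : G.Adj y c) (hwc : G.Adj w c)
    (hy2 : G.degree y = 2) (hw2 : G.degree w = 2) : G.degree c ≤ 15 := by
  classical
  by_contra! hc
  -- For `c` of degree `16` the form in `(a w, a c)` is a positive multiple of `(a w) ^ 2` plus a
  -- negative multiple of `a w * a c`, so `a c` has to be large compared with `a w`.
  let a : V → ℝ := fun z => if z = w then 1 else if z = c then 25 else 0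
  have haw : a w = 1 := by simp [a]
  have hac : a c = 25 := by simp [a, hwc.ne']
  have key := reducedForm_nonneg (a := a) hC4 hy (S := {w, c}) (by simp [hyw, hyc])
    (by
      intro s _ z hyz _
      have hz := (G.mem_neighborFinset y z).2 hyz
      rwa [neighborFinset_eq_pair hy2 hyw hyc hwc.ne] at hz)
    (by simp +contextual [a])
  rw [Finset.sum_pair hwc.ne, Finset.sum_pair hwc.ne, reducedTerm_of_triangle hC4 hyw hyc hwc,
    reducedTerm_of_triangle hC4 hyc hyw hwc.symm, haw, hac, hy2, hw2] at key
  have h1 := div_two_mul_degree_le (G := G) (by norm_num) hc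
    (c := 4 * 25 ^ 2 + (1 - 2 * 25) ^ 2) (by norm_num)
  norm_num at key h1
  linarith

end TestFunctions

/-! ### Connected two-regular graphs -/

section TwoRegular

variable {V : Type*} {G : SimpleGraph V}

theorem Connected.forall_of_adj (hconn : G.Connected) {P : V → Prop} {x : V} (hx : P x)
    (hP : ∀ u v, G.Adj u v → P u → P v) (y : V) : P y := by
  obtain ⟨w⟩ := hconn.preconnected x y
  induction w with
  | nil => exact hx
  | cons h _ ih => exact ih (hP _ _ h hx)

variable [G.LocallyFinite]

/-- In a two-regular graph the directed edges are permuted by going straight ahead. -/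
theorem exists_perm_dart (h2 : ∀ x, G.degree x = 2) :
    ∃ σ : Equiv.Perm G.Dart, ∀ d, (σ d).fst = d.snd ∧ (σ d).snd ≠ d.fst := by
  classical
  have hother : ∀ d : G.Dart, ∃ w, G.Adj d.snd w ∧ w ≠ d.fst := fun d => by
    obtain ⟨w, hw, hne⟩ := Finset.exists_mem_ne (s := G.neighborFinset d.snd)
      (by rw [card_neighborFinset_eq_degree, h2]; norm_num) d.fst
    exact ⟨w, by simpa using hw, hne⟩
  choose other hadj hne using hother
  -- Going straight ahead and then turning round is an involution.
  let τ : G.Dart → G.Dart := fun d => ⟨(other d, d.snd), (hadj d).symm⟩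
  have hτ : Function.Involutive τ := by
    intro d
    refine Dart.ext _ _ (Prod.ext ?_ rfl)
    have hN := neighborFinset_eq_pair (h2 d.snd) d.adj.symm (hadj d) (hne d).symm
    have hmem := (G.mem_neighborFinset d.snd (other (τ d))).2 (hadj (τ d))
    rw [hN, Finset.mem_insert, Finset.mem_singleton] at hmem
    exact hmem.resolve_right (hne (τ d))
  exact ⟨hτ.toPerm.trans Dart.symm_involutive.toPerm, fun d => ⟨rfl, hne d⟩⟩

/-- A connected two-regular graph is a quotient of the line by a group of translations. -/
theorem exists_line_covering (hconn : G.Connected) (h2 : ∀ x, G.degree x = 2) :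
    ∃ (p : ℤ → V) (n : ℕ), Function.Surjective p ∧ (∀ i j, p i = p j ↔ (n : ℤ) ∣ j - i) ∧
      (∀ i v, G.Adj (p i) v ↔ v = p (i - 1) ∨ v = p (i + 1)) ∧ ∀ i, p (i + 2) ≠ p i := by
  classical
  obtain ⟨σ, hσ⟩ := exists_perm_dart h2
  obtain ⟨x₀⟩ := hconn.nonempty
  obtain ⟨y₀, hy₀⟩ := (G.degree_pos_iff_exists_adj x₀).1 (by rw [h2]; norm_num)
  let d : ℤ → G.Dart := fun i => (σ ^ i) ⟨(x₀, y₀), hy₀⟩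
  have hd : ∀ i, d (i + 1) = σ (d i) := fun i => by
    simp only [d, add_comm i 1, zpow_add, zpow_one, Equiv.Perm.mul_apply]
  let p : ℤ → V := fun i => (d i).fst
  have hsnd : ∀ i, (d i).snd = p (i + 1) := fun i => by
    simp only [p, hd, (hσ _).1]
  have hadj : ∀ i, G.Adj (p i) (p (i + 1)) := fun i => hsnd i ▸ (d i).adj
  have hne : ∀ i, p (i + 2) ≠ p i := fun i => by
    have h := (hσ (d i)).2
    rwa [← hd, hsnd, add_assoc, one_add_one_eq_two] at h
  have hnbr : ∀ i v, G.Adj (p i) v ↔ v = p (i - 1) ∨ v = p (i + 1) := by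
    intro i v
    have h1 : G.Adj (p i) (p (i - 1)) := by
      have := hadj (i - 1)
      rw [sub_add_cancel] at this
      exact this.symm
    have h3 : p (i - 1) ≠ p (i + 1) := by
      have := hne (i - 1)
      rw [show i - 1 + 2 = i + 1 by ring] at this
      exact this.symm
    rw [← mem_neighborFinset, neighborFinset_eq_pair (h2 _) h1 (hadj i) h3, Finset.mem_insert,
      Finset.mem_singleton]
  have hsurj : Function.Surjective p := by
    refine hconn.forall_of_adj (x := p 0) ⟨0, rfl⟩ ?_
    rintro _ v huv ⟨i, rfl⟩
    rcases (hnbr i v).1 huv with rfl | rfl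
    exacts [⟨_, rfl⟩, ⟨_, rfl⟩]
  set n := MulAction.period σ (⟨(x₀, y₀), hy₀⟩ : G.Dart) with hn
  have hperiod : ∀ i j, d i = d j ↔ (n : ℤ) ∣ j - i := by
    intro i j
    rw [hn, ← MulAction.zpow_smul_eq_iff_period_dvd, eq_comm, Equiv.Perm.smul_def, sub_eq_neg_add,
      zpow_add, Equiv.Perm.mul_apply, zpow_neg, Equiv.Perm.inv_eq_iff_eq]
  refine ⟨p, n, hsurj, fun i j => ⟨?_, fun h => congrArg (fun e => e.fst) ((hperiod i j).2 h)⟩,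
    hnbr, hne⟩
  intro hij
  wlog hle : i ≤ j generalizing i j
  · rw [← dvd_neg, neg_sub]
    exact this j i hij.symm (by omega)
  have hcase : p (i + 1) = p (j - 1) ∨ p (i + 1) = p (j + 1) :=
    (hnbr j _).1 (hij ▸ hadj i)
  rcases hcase with href | hsame
  · -- The map `p` would be symmetric under a reflection, which is impossible at its centre.
    exfalso
    have hrefl : ∀ k : ℕ, p (i + k) = p (j - k) ∧ p (i + k + 1) = p (j - k - 1) := by
      intro k
      induction k with
      | zero => simpa using ⟨hij, href⟩
      | succ k ih =>
        obtain ⟨ih1, ih2⟩ := ih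
        push_cast
        rw [← add_assoc, ← sub_sub]
        refine ⟨ih2, ?_⟩
        have h := hadj (i + k + 1)
        rw [ih2, hnbr] at h
        refine h.resolve_right fun h' => hne (i + k) ?_
        rw [ih1, show i + k + 2 = i + k + 1 + 1 by ring, h', sub_add_cancel]
    obtain ⟨k, hk⟩ := Int.eq_ofNat_of_zero_le (show 0 ≤ (j - i) / 2 by omega)
    obtain ⟨h1, h3⟩ := hrefl k
    rcases Int.emod_two_eq_zero_or_one (j - i) with h | h
    · refine hne (i + k - 1) ?_
      rw [show i + k - 1 + 2 = i + k + 1 by ring, h3]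
      congr 1
      omega
    · refine (hadj (i + k)).ne ?_
      rw [h1]
      congr 1
      omega
  · rw [← hperiod]
    refine Dart.ext _ _ (Prod.ext hij ?_)
    rw [hsnd, hsnd, hsame]

theorem infiniteLine_adj {i j : ℤ} : BakryEmery.infiniteLine.Adj i j ↔ j = i - 1 ∨ j = i + 1 := by
  rw [hasse_adj, Order.covBy_iff_add_one_eq, Order.covBy_iff_add_one_eq]
  omega

theorem nonempty_iso_cycleGraph_or_infiniteLine (hconn : G.Connected)
    (hC4 : (cycleGraph 4).Free G) (h2 : ∀ x, G.degree x = 2)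
    (hfree : ∀ x y z, G.Adj x y → G.Adj x z → ¬ G.Adj y z) :
    (∃ n : ℕ, 5 ≤ n ∧ Nonempty (G ≃g cycleGraph n)) ∨ Nonempty (G ≃g BakryEmery.infiniteLine) := by
  obtain ⟨p, n, hsurj, hp, hnbr, hne⟩ := exists_line_covering hconn h2
  have hadj : ∀ i j, G.Adj (p i) (p j) ↔ p (i - 1) = p j ∨ p (i + 1) = p j := fun i j => by
    rw [hnbr, eq_comm, eq_comm (a := p (i + 1))]
  have hsucc : ∀ i, G.Adj (p i) (p (i + 1)) := fun i => (hadj _ _).2 (Or.inr rfl)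
  rcases Nat.eq_zero_or_pos n with rfl | hpos
  · right
    have hinj : ∀ {i j}, p i = p j ↔ j = i := fun {i j} => by
      rw [hp, Nat.cast_zero, zero_dvd_iff, sub_eq_zero]
    have hbij : Function.Bijective p := ⟨fun _ _ h => (hinj.1 h).symm, hsurj⟩
    refine ⟨RelIso.symm ⟨Equiv.ofBijective p hbij, fun {i j} => ?_⟩⟩
    change G.Adj (p i) (p j) ↔ _
    rw [hadj, hinj, hinj, infiniteLine_adj]
  · left
    have hn5 : 5 ≤ n := by
      by_contra! hlt
      have hper : p n = p 0 := (hp _ _).2 (by simp)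
      interval_cases n
      · exact (hsucc 0).ne hper.symm
      · exact hne 0 hper
      · refine hfree (p 1) (p 0) (p 2) (hsucc 0).symm (hsucc 1) ?_
        rw [← hper]
        exact (hsucc 2).symm
      · refine hne 1 (eq_of_common_neighbors hC4 (hne 0) (hsucc 2) ?_ (hsucc 1).symm (hsucc 0))
        change G.Adj (p 0) (p 3)
        rw [← hper]
        exact (hsucc 3).symm
    have hinj : Function.Injective fun k : Fin n => p (k : ℕ) := by
      intro i j hij
      have h := Int.eq_zero_of_abs_lt_dvd ((hp _ _).1 hij) (by have := i.2; have := j.2; grind)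
      ext
      omega
    have hsurj' : Function.Surjective fun k : Fin n => p (k : ℕ) := by
      intro v
      obtain ⟨i, rfl⟩ := hsurj v
      have h0 := Int.emod_nonneg i (show (n : ℤ) ≠ 0 by omega)
      have h1 := Int.emod_lt_of_pos i (show (0 : ℤ) < n by omega)
      refine ⟨⟨(i % n).toNat, by omega⟩, ?_⟩
      simp only [Int.toNat_of_nonneg h0]
      exact (hp _ _).2 (Int.dvd_self_sub_emod)
    refine ⟨n, hn5, ⟨RelIso.symm ⟨Equiv.ofBijective _ ⟨hinj, hsurj'⟩, fun {u v} => ?_⟩⟩⟩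
    · have hsub : ∀ u v : Fin n, (v - u).val = 1 ↔ p ((u : ℕ) + 1) = p (v : ℕ) := by
        intro u v
        rw [hp, Fin.sub_def, ← Int.natCast_inj]
        have hu := u.2
        push_cast [hu.le]
        have hone : (1 : ℤ) % n = 1 := Int.emod_eq_of_lt (by norm_num) (by omega)
        have hmod : ((n : ℤ) - u + v) % n = 1 ↔ (n : ℤ) - u + v ≡ 1 [ZMOD n] := by
          rw [Int.ModEq, hone]
        rw [hmod, Int.modEq_comm, Int.modEq_iff_dvd,
          show (n : ℤ) - u + v - 1 = n + (v - (u + 1)) by ring, dvd_add_right (dvd_refl _)]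
      have hflip : p ((u : ℕ) - 1) = p (v : ℕ) ↔ p ((v : ℕ) + 1) = p (u : ℕ) := by
        rw [hp, hp, ← dvd_neg]
        congr! 1
        ring
      change G.Adj (p (u : ℕ)) (p (v : ℕ)) ↔ _
      rw [hadj, cycleGraph_adj', hsub, hsub, hflip]

end TwoRegular

/-! ### Triangles with a common vertex -/

section Friendship

variable {V : Type*} {G : SimpleGraph V} [G.LocallyFinite]

/-- If all vertices other than `c` are adjacent to `c` and the neighbours of `c` are perfectly
matched by the remaining edges, the graph is a friendship graph. -/
theorem exists_iso_friendshipGraph (hC4 : (cycleGraph 4).Free G) {c : V}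
    (hc : ∀ v, v ≠ c → G.Adj c v) (htri : ∀ v, G.Adj c v → ∃ w, G.Adj c w ∧ G.Adj v w) :
    ∃ k : ℕ, 2 * k ≤ G.degree c ∧ Nonempty (G ≃g BakryEmery.friendshipGraph k) := by
  classical
  have hmate : ∀ v : G.neighborSet c, ∃ w : G.neighborSet c, G.Adj v w := fun v => by
    obtain ⟨w, hw, hvw⟩ := htri v v.2
    exact ⟨⟨w, hw⟩, hvw⟩
  choose τ hτ using hmate
  have huniq : ∀ v w : G.neighborSet c, G.Adj v w → w = τ v := fun v w h =>
    Subtype.ext (eq_of_common_neighbors hC4 (G.ne_of_adj v.2) w.2 h (τ v).2 (hτ v))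
  have hττ : ∀ v, τ (τ v) = v := fun v => (huniq _ _ (hτ v).symm).symm
  -- An arbitrary numbering of the neighbours of `c` selects one vertex of each matched pair.
  let r := Fintype.equivFin (G.neighborSet c)
  let S := {v : G.neighborSet c // r v < r (τ v)}
  let e := (Fintype.equivFin S).symm
  let F : Option (Fin (Fintype.card S) × Bool) → V
    | none => c
    | some (i, true) => (e i).1
    | some (i, false) => τ (e i).1
  have hmixed : ∀ i j, (e i).1 ≠ τ (e j).1 := by
    intro i j h
    have hi := (e i).2
    have hj := (e j).2
    rw [h, hττ] at hi
    exact lt_asymm hi hj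
  have hFN : ∀ q, G.Adj c (F (some q)) := by
    rintro ⟨i, _ | _⟩
    exacts [(τ (e i).1).2, (e i).1.2]
  have hFinj : Function.Injective F := by
    have hsome : ∀ q q', F (some q) = F (some q') → q = q' := by
      rintro ⟨i, _ | _⟩ ⟨j, _ | _⟩ h
      · have h' := congrArg τ (Subtype.ext h)
        rw [hττ, hττ] at h'
        rw [e.injective (Subtype.ext h')]
      · exact absurd (Subtype.ext h).symm (hmixed j i)
      · exact absurd (Subtype.ext h) (hmixed i j)
      · rw [e.injective (Subtype.ext (Subtype.ext h))]
    rintro (_ | q) (_ | q') h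
    · rfl
    · exact absurd h (hFN q').ne
    · exact absurd h (hFN q).ne'
    · rw [hsome q q' h]
  have hFsurj : Function.Surjective F := by
    intro v
    by_cases hv : v = c
    · exact ⟨none, hv.symm⟩
    let v' : G.neighborSet c := ⟨v, hc v hv⟩
    rcases lt_trichotomy (r v') (r (τ v')) with h | h | h
    · refine ⟨some (e.symm ⟨v', h⟩, true), ?_⟩
      simp [F, v']
    · have := hτ v'
      rw [← r.injective h] at this
      exact absurd this (G.loopless.irrefl _)
    · refine ⟨some (e.symm ⟨τ v', by rwa [hττ]⟩, false), ?_⟩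
      simp [F, hττ, v']
  have hadj : ∀ v w : G.neighborSet c, G.Adj v w ↔ w = τ v :=
    fun v w => ⟨huniq v w, fun h => h ▸ hτ v⟩
  refine ⟨Fintype.card S, ?_, ⟨RelIso.symm ⟨Equiv.ofBijective F ⟨hFinj, hFsurj⟩, ?_⟩⟩⟩
  · have hcard := Fintype.card_le_of_injective
      (fun q : Fin (Fintype.card S) × Bool => (⟨F (some q), hFN q⟩ : G.neighborSet c))
      fun q q' h => Option.some_injective _ (hFinj (congrArg Subtype.val h))
    rw [Fintype.card_prod, Fintype.card_fin, Fintype.card_bool, mul_comm] at hcard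
    exact hcard.trans_eq (G.card_neighborSet_eq_degree c)
  · intro u v
    change G.Adj (F u) (F v) ↔ _
    simp only [BakryEmery.friendshipGraph]
    rcases u with _ | ⟨i, b⟩ <;> rcases v with _ | ⟨j, b'⟩
    · simp [F]
    · simpa using hFN (j, b')
    · simpa using (hFN (i, b)).symm
    · have hee : ∀ {i j}, (e i).1 = (e j).1 ↔ i = j := fun {i j} =>
        ⟨fun h => e.injective (Subtype.ext h), fun h => h ▸ rfl⟩
      have hτinj : Function.Injective τ := Function.LeftInverse.injective hττ
      cases b <;> cases b'
      · change G.Adj (τ (e i).1) (τ (e j).1) ↔ _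
        rw [hadj, hττ]
        simp [(hmixed i j).symm]
      · change G.Adj (τ (e i).1) (e j).1 ↔ _
        rw [hadj, hττ, hee]
        simp [eq_comm]
      · change G.Adj (e i).1 (τ (e j).1) ↔ _
        rw [hadj, hτinj.eq_iff, hee]
        simp [eq_comm]
      · change G.Adj (e i).1 (e j).1 ↔ _
        rw [hadj]
        simp [hmixed j i]

end Friendship

/-! ### The classification -/

section Classification

variable {V : Type*} {G : SimpleGraph V} [G.LocallyFinite]

theorem degree_le_two {x u v : V} (h : ∀ y, G.Adj x y → y = u ∨ y = v) : G.degree x ≤ 2 := by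
  classical
  rw [← card_neighborFinset_eq_degree]
  refine (Finset.card_le_card (t := {u, v}) fun y hy => ?_).trans Finset.card_le_two
  simpa using h y ((G.mem_neighborFinset x y).1 hy)

theorem degree_le_two_of_iso_cycleGraph {n : ℕ} (hn : 2 ≤ n) (e : G ≃g cycleGraph n) (x : V) :
    G.degree x ≤ 2 := by
  obtain ⟨m, rfl⟩ := Nat.exists_eq_add_of_le' hn
  refine degree_le_two (u := e.symm (e x - 1)) (v := e.symm (e x + 1)) fun y hxy => ?_
  rw [← e.map_adj_iff, cycleGraph_adj] at hxy
  rcases hxy with h | h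
  · left
    rw [← h, sub_sub_cancel, RelIso.symm_apply_apply]
  · right
    rw [← h, add_sub_cancel, RelIso.symm_apply_apply]

theorem degree_le_two_of_iso_infiniteLine (e : G ≃g BakryEmery.infiniteLine) (x : V) :
    G.degree x ≤ 2 := by
  refine degree_le_two (u := e.symm (e x - 1)) (v := e.symm (e x + 1)) fun y hxy => ?_
  rw [← e.map_adj_iff, infiniteLine_adj] at hxy
  rcases hxy with h | h
  · left
    rw [← h, RelIso.symm_apply_apply]
  · right
    rw [← h, RelIso.symm_apply_apply]

theorem curvatureForm_nonneg_of_iso_friendshipGraph (hdeg : ∀ x, 2 ≤ G.degree x) {k : ℕ}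
    (hk : k ≤ 7) (e : G ≃g BakryEmery.friendshipGraph k) (x : V) (f : V → ℝ) :
    0 ≤ G.curvatureForm f x := by
  classical
  set c := e.symm none with hcdef
  have hec : e c = none := e.apply_symm_apply none
  have hnone : ∀ y, y ≠ c → e y ≠ none := fun y hy h => hy (e.injective (h.trans hec.symm))
  have hadj : ∀ y, y ≠ c → G.Adj y c := fun y hy => by
    rw [← e.map_adj_iff, hec]
    exact ⟨hnone y hy, Or.inr (Or.inl rfl)⟩
  have hdeg2 : ∀ y, y ≠ c → G.degree y = 2 := by
    intro y hy
    refine le_antisymm ?_ (hdeg y)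
    obtain ⟨⟨i, b⟩, hey⟩ := Option.ne_none_iff_exists'.1 (hnone y hy)
    refine degree_le_two (u := c) (v := e.symm (some (i, !b))) fun z hyz => ?_
    rw [← e.map_adj_iff, hey] at hyz
    rw [← e.injective.eq_iff, hec, ← e.injective.eq_iff (b := e.symm _), e.apply_symm_apply]
    generalize e z = q at hyz
    rcases q with _ | ⟨j, b'⟩
    · exact Or.inl rfl
    · right
      obtain ⟨hne, h⟩ := hyz
      simp only [reduceCtorEq, Option.map_some, Option.some_inj, false_or] at h
      subst h
      cases b <;> cases b' <;> simp_all
  by_cases hx : x = c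
  · exact curvatureForm_nonneg_of_degree_eq_two
      (fun y hxy => hdeg2 y fun h => hxy.ne (hx.trans h.symm)) f
  · have hxc := hadj x hx
    obtain ⟨w, hw, hwc⟩ := Finset.exists_mem_ne (s := G.neighborFinset x)
      (by rw [card_neighborFinset_eq_degree]; exact hdeg x) c
    have hxw := (G.mem_neighborFinset x w).1 hw
    refine curvatureForm_nonneg_of_triangle hxw hxc (hadj w hwc) (hdeg2 x hx) (hdeg2 w hwc) ?_ f
    let _ : Fintype V := Fintype.ofEquiv _ e.symm.toEquiv
    have hcard : Fintype.card V = k * 2 + 1 := by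
      rw [Fintype.card_congr e.toEquiv]
      simp
    have := Finset.card_lt_univ_of_notMem (G.notMem_neighborFinset_self c)
    rw [card_neighborFinset_eq_degree] at this
    omega

/-- A connected graph with nonnegative curvature in which some edge lies in no triangle is
two-regular and triangle-free: both properties spread along the edges. -/
theorem degree_eq_two_and_triangle_free (hconn : G.Connected) (hC4 : (cycleGraph 4).Free G)
    (hdeg : ∀ x, 2 ≤ G.degree x) (hcurv : ∀ x f, 0 ≤ G.curvatureForm f x) {x y : V}
    (hxy : G.Adj x y) (hno : ∀ z, G.Adj x z → ¬ G.Adj y z) (v : V) :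
    G.degree v = 2 ∧ ∀ z, G.Adj v z → ∀ w, G.Adj v w → ¬ G.Adj z w := by
  classical
  have hspread : ∀ u v, G.Adj u v → (∀ z, G.Adj u z → ¬ G.Adj v z) →
      G.degree v = 2 ∧ ∀ z, G.Adj v z → ∀ w, G.Adj v w → ¬ G.Adj z w := by
    intro u v huv h
    have hv := degree_eq_two_of_no_common_neighbor hC4 hdeg (hcurv u) huv h
    refine ⟨hv, fun z hvz w hvw hzw => ?_⟩
    -- One of the two neighbours `z` and `w` of `v` has to be `u`.
    have hu := (G.mem_neighborFinset v u).2 huv.symm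
    rw [neighborFinset_eq_pair hv hvz hvw hzw.ne, Finset.mem_insert, Finset.mem_singleton] at hu
    rcases hu with rfl | rfl
    exacts [h w hzw hvw, h z hzw.symm hvz]
  exact hconn.forall_of_adj (hspread x y hxy hno) (fun u v huv hu => hspread u v huv
    fun z huz hvz => hu.2 v huv z huz hvz) v

/-- A connected graph with nonnegative curvature in which every edge lies in a triangle is a
friendship graph. -/
theorem exists_iso_friendshipGraph_of_triangles (hconn : G.Connected)
    (hC4 : (cycleGraph 4).Free G) (hdeg : ∀ x, 2 ≤ G.degree x)
    (hcurv : ∀ x f, 0 ≤ G.curvatureForm f x)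
    (htri : ∀ x y, G.Adj x y → ∃ z, G.Adj x z ∧ G.Adj y z) :
    ∃ k : ℕ, 1 ≤ k ∧ k ≤ 7 ∧ Nonempty (G ≃g BakryEmery.friendshipGraph k) := by
  classical
  obtain ⟨c, hc⟩ : ∃ c, ∀ y, G.Adj c y → G.degree y = 2 := by
    by_cases h : ∃ c, 3 ≤ G.degree c
    · obtain ⟨c, hc⟩ := h
      exact ⟨c, fun y hcy =>
        degree_eq_two_of_adj_of_three_le_degree hC4 hdeg htri (hcurv c) hcy hc⟩
    · push Not at h
      obtain ⟨c⟩ := hconn.nonempty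
      exact ⟨c, fun y _ => le_antisymm (Nat.le_of_lt_succ (h y)) (hdeg y)⟩
  have hall : ∀ v, v = c ∨ G.Adj c v := by
    refine hconn.forall_of_adj (Or.inl rfl) ?_
    rintro u v huv (rfl | hcu)
    · exact Or.inr huv
    · obtain ⟨w, hcw, huw⟩ := htri c u hcu
      have hv := (G.mem_neighborFinset u v).2 huv
      rw [neighborFinset_eq_pair (hc u hcu) hcu.symm huw hcw.ne, Finset.mem_insert,
        Finset.mem_singleton] at hv
      rcases hv with rfl | rfl
      exacts [Or.inl rfl, Or.inr hcw]
  obtain ⟨k, hk, ⟨e⟩⟩ := exists_iso_friendshipGraph hC4 (fun v hv => (hall v).resolve_left hv)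
    (fun v hcv => htri c v hcv)
  obtain ⟨y, hcy⟩ := (G.degree_pos_iff_exists_adj c).1 (by have := hdeg c; omega)
  obtain ⟨w, hcw, hyw⟩ := htri c y hcy
  have hc15 := degree_le_of_triangle hC4 (hcurv y) hyw hcy.symm hcw.symm (hc y hcy) (hc w hcw)
  refine ⟨k, Nat.one_le_iff_ne_zero.2 ?_, by omega, ⟨e⟩⟩
  rintro rfl
  exact hcy.ne (e.injective (Subsingleton.elim _ _))

end Classification
end SimpleGraph

theorem theorem2p6 {V : Type*} (G : SimpleGraph V) [G.LocallyFinite] (hconn : G.Connected)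
    (hC4 : (SimpleGraph.cycleGraph 4).Free G) (hdeg : ∀ x : V, 2 ≤ G.degree x) :
    BakryEmery.NormalizedCD G 0 ⊤ ↔
      (∃ n : ℕ, 5 ≤ n ∧ Nonempty (G ≃g SimpleGraph.cycleGraph n)) ∨
      Nonempty (G ≃g BakryEmery.infiniteLine) ∨
      (∃ k : ℕ, 1 ≤ k ∧ k ≤ 7 ∧ Nonempty (G ≃g BakryEmery.friendshipGraph k)) := by
  rw [SimpleGraph.normalizedCD_zero_top_iff G hdeg]
  constructor
  · intro hcurv
    by_cases htri : ∀ x y, G.Adj x y → ∃ z, G.Adj x z ∧ G.Adj y z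
    · exact Or.inr (Or.inr
        (SimpleGraph.exists_iso_friendshipGraph_of_triangles hconn hC4 hdeg hcurv htri))
    · push Not at htri
      obtain ⟨x, y, hxy, hno⟩ := htri
      have h := SimpleGraph.degree_eq_two_and_triangle_free hconn hC4 hdeg hcurv hxy hno
      rw [← or_assoc]
      exact Or.inl (SimpleGraph.nonempty_iso_cycleGraph_or_infiniteLine hconn hC4 (fun v => (h v).1)
        fun v z w hvz hvw => (h v).2 z hvz w hvw)
  · rintro (⟨n, hn, ⟨e⟩⟩ | ⟨⟨e⟩⟩ | ⟨k, -, hk, ⟨e⟩⟩) x f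
    · exact SimpleGraph.curvatureForm_nonneg_of_degree_eq_two (fun y _ =>
        le_antisymm (SimpleGraph.degree_le_two_of_iso_cycleGraph (by omega) e y) (hdeg y)) f
    · exact SimpleGraph.curvatureForm_nonneg_of_degree_eq_two (fun y _ =>
        le_antisymm (SimpleGraph.degree_le_two_of_iso_infiniteLine e y) (hdeg y)) f
    · exact SimpleGraph.curvatureForm_nonneg_of_iso_friendshipGraph hdeg hk e x f
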